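/- **Setting.** Let $N\ge 1$, $[N]=\{1,\dots,N\}$, and let $h_i,f_i,g:\mathbb R^n\to\mathbb R\cup\{\infty\}$, $i\in[N]$. Put $C=\bigcap_i\operatorname{int}\operatorname{dom}h_i$ and $\varphi=\frac1N\sum_{i=1}^N f_i+g$. Assume: * each $h_i$ is a *Legendre kernel*: proper, lsc, strictly convex, $C^1$ on $\operatorname{int}\operatorname{dom}h_i\neq\emptyset$, with $h_i(x)/\|x\|\to\infty$ as $\|x\|\to\infty$, and with $\|\nabla h_i(x_k)\|\to\infty$ whenever $\operatorname{int}\operatorname{dom}h_i\ni x_k\to x\in\partial\operatorname{dom}h_i$; * each $f_i$ is $L_{f_i}$-smooth relative to $h_i$: $f_i$ is proper and lsc, $\operatorname{dom}f_i\supseteq\operatorname{dom}h_i$, $L_{f_i}\ge0$, and $L_{f_i}h_i\pm f_i$ are convex on $\operatorname{int}\operatorname{dom}h_i$; * $g$ is proper and lsc, and $\operatorname{argmin}_{\overline C}\varphi\ne\emptyset$; * the stepsizes satisfy $\gamma_i\in(0,N/L_{f_i})$ (with $N/0=\infty$), and for every $s\in\mathbb R^n$ $$T(s)=\operatorname*{argmin}_{w\in\mathbb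 R^n}\Big\{g(w)+\sum_{i=1}^N\tfrac1{\gamma_i}h_i(w)-\langle s,w\rangle\Big\}\subseteq C.$$ For a function $\psi$, let $\psi^*$ be its convex conjugate and let $D_\psi(x,y)=\psi(x)-\psi(y)-\langle\nabla\psi(y),x-y\rangle$ if $y\in\operatorname{int}\operatorname{dom}\psi$, and $D_\psi(x,y)=\infty$ otherwise. Put $\hat h_i=\frac{1}{\gamma_i}h_i-\frac1N f_i$ (with $\infty-\infty=\infty$) and $$\mathcal L(z,\mathbf s)=\varphi(z)+\sum_{i=1}^N D_{\hat h_i^*}\big(s_i,\nabla\hat h_i(z)\big).$$ **Algorithm (Bregman Finito/MISO).** Given $x^{\rm init}\in C$, set $s_i^0=\frac1{\gamma_i}\nabla h_i(x^{\rm init})-\frac1N\nabla f_i(x^{\rm init})$ and $\tilde s^0=\sum_i s_i^0$. For $k=0,1,\dots$: pick any $z^k\in T(\tilde s^k)$; select $\mathcal I^{k+1}\subseteq[N]$; set $s_i^{k+1}=\frac1{\gamma_i}\nabla h_i(z^k)-\frac1N\nabla f_i(z^k)$ for $i\in\mathcal I^{k+1}$ and $s_i^{k+1}=s_i^k$ otherwise;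 set $\tilde s^{k+1}=\tilde s^k+\sum_{i\in\mathcal I^{k+1}}(s_i^{k+1}-s_i^k)$. **Theorem (subsequential convergence with the essentially cyclic rule).** In addition, assume that $g$ is convex, that $C=\mathbb R^n$, and that either 1. each $h_i$ is strongly convex and has Lipschitz continuous gradient on $\mathbb R^n$, or 2. $\varphi$ is level bounded (all sublevel sets $\{\varphi\le\alpha\}$, $\alpha\in\mathbb R$, are bounded) and each $h_i$ is locally strongly convex and has locally Lipschitz gradient. Let the index sets be essentially cyclic: there is an integer $T>0$ with $\bigcup_{t=1}^{T}\mathcal I^{k+t}=[N]$ for all $k\in\mathbb N$. Then every sequence $(z^k,\mathbf s^k,\tilde s^k)_{k\in\mathbb N}$ generated by the algorithm satisfies the following, where $\omega$ is the set of limit points of $(z^k)$: * for each $i\in[N]$, the sequence $D_{\hat h_i^*}(s_i^k,\nabla\hat h_i(z^k))$ consists of nonnegative real numbers with finite sum, and in particular vanishes as $k\to\infty$; * $\mathcal L(z^k,\mathbf s^k)$ is nonincreasing in $k$ and converges to a finite value $\varphi_\star\ge\inf\varphi$; also $\varphi(z^k)\to\varphi_\star$, and $\varphi_\star\le\varphi(x^{\rm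 init})$; * $\varphi\equiv\varphi_\star$ on $\omega$; * $0\in\hat\partial\varphi(z^\star)$ for every $z^\star\in\omega$, where $v\in\hat\partial\varphi(\bar x)$ means that $\varphi(\bar x)<\infty$ and $\liminf_{\bar x\ne x\to\bar x}\frac{\varphi(x)-\varphi(\bar x)-\langle v,x-\bar x\rangle}{\|x-\bar x\|}\ge0$. -/

import Mathlib

open Filter Topology
open scoped BigOperators

namespace BFinito

noncomputable section

variable {E : Type*} [NormedAddCommGroup E] [InnerProductSpace ℝ E] [CompleteSpace E]

/-! ### Extended-real-valued functions

Functions with values in `ℝ ∪ {∞}` are modelled as functions to `EReal` that never take the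
value `⊥` (this is part of `IsProper`). -/

/-- The effective domain `{x | f x < ∞}`. -/
def effDom (f : E → EReal) : Set E := {x | f x < ⊤}

/-- `f` takes values in `ℝ ∪ {∞}` and its domain is nonempty. -/
def IsProper (f : E → EReal) : Prop := (∀ x, f x ≠ ⊥) ∧ (effDom f).Nonempty

/-- The real-valued version of `f`, meaningful on the domain of `f` only. -/
def realVal (f : E → EReal) : E → ℝ := fun x => (f x).toReal

/-- The gradient of `f`, meaningful at points of the interior of the domain. -/
def grad (f : E → EReal) (x : E) : E := gradient (realVal f) x

/-- Convexity of an extended-real-valued function: the epigraph is convex. -/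
def IsConvexFun (f : E → EReal) : Prop := Convex ℝ {p : E × ℝ | f p.1 ≤ (p.2 : EReal)}

/-- All sublevel sets of `f` at real levels are bounded. -/
def LevelBounded (f : E → EReal) : Prop :=
  ∀ α : ℝ, Bornology.IsBounded {x | f x ≤ (α : EReal)}

/-- The set of minimizers of `f` over `S` (empty if `f ≡ ∞` on `S`). -/
def argminOn (f : E → EReal) (S : Set E) : Set E :=
  {x | x ∈ S ∧ f x < ⊤ ∧ ∀ y ∈ S, f x ≤ f y}

/-- The convex conjugate `f^*(y) = sup_x (⟨y, x⟩ - f x)`. -/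
def fenchelConj (f : E → EReal) (y : E) : EReal := ⨆ x : E, ((inner ℝ y x : ℝ) : EReal) - f x

/-- The regular (Fréchet) subdifferential of `f` at a point `x` of its domain. -/
def regSubdiff (f : E → EReal) (x : E) : Set E :=
  {v | f x < ⊤ ∧
    0 ≤ liminf (fun y => (f y - f x - ((inner ℝ v (y - x) : ℝ) : EReal)) / ((‖y - x‖ : ℝ) : EReal))
      (𝓝[≠] x)}

open Classical in
/-- The Bregman distance `D_f(x, y)`, equal to `∞` if `y` is not in the interior of the domain. -/
def bregman (f : E → EReal) (x y : E) : EReal :=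
  if y ∈ interior (effDom f) then f x - f y - ((inner ℝ (grad f y) (x - y) : ℝ) : EReal) else ⊤

/-- Legendre kernels: proper, lsc, strictly convex, `C^1` on the nonempty interior of the domain,
`1`-coercive and essentially smooth. -/
structure IsLegendre (h : E → EReal) : Prop where
  proper : IsProper h
  lsc : LowerSemicontinuous h
  strictConvex : StrictConvexOn ℝ (effDom h) (realVal h)
  interior_nonempty : (interior (effDom h)).Nonempty
  contDiffOn : ContDiffOn ℝ 1 (realVal h) (interior (effDom h))
  coercive : Tendsto (fun x => h x / ((‖x‖ : ℝ) : EReal)) (Bornology.cobounded E) (𝓝 ⊤)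
  essSmooth : ∀ (u : ℕ → E) (x : E), (∀ k, u k ∈ interior (effDom h)) →
    x ∈ frontier (effDom h) → Tendsto u atTop (𝓝 x) →
    Tendsto (fun k => ‖grad h (u k)‖) atTop atTop

/-- `f` is `L`-smooth relative to `h`: `f` is proper and lsc, `dom h ⊆ dom f`, `L ≥ 0`, and
`L h + f` and `L h - f` are convex on the interior of the domain of `h`. -/
structure IsRelSmooth (L : ℝ) (f h : E → EReal) : Prop where
  proper : IsProper f
  lsc : LowerSemicontinuous f
  dom_subset : effDom h ⊆ effDom f
  modulus_nonneg : 0 ≤ L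
  convex_add : ConvexOn ℝ (interior (effDom h)) (fun x => L * realVal h x + realVal f x)
  convex_sub : ConvexOn ℝ (interior (effDom h)) (fun x => L * realVal h x - realVal f x)

/-- Strong convexity on the whole space, with some modulus `μ > 0`. -/
def StronglyConvex (h : E → EReal) : Prop :=
  ∃ μ : ℝ, 0 < μ ∧ StrongConvexOn Set.univ μ (realVal h)

/-- `h` is strongly convex on some neighborhood of every point. -/
def LocallyStronglyConvex (h : E → EReal) : Prop :=
  ∀ x : E, ∃ U ∈ 𝓝 x, ∃ μ : ℝ, 0 < μ ∧ StrongConvexOn U μ (realVal h)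

/-- `h` is differentiable with (globally) Lipschitz gradient. -/
def LipschitzDifferentiable (h : E → EReal) : Prop :=
  Differentiable ℝ (realVal h) ∧ ∃ ℓ : NNReal, LipschitzWith ℓ (grad h)

/-- `h` is differentiable with locally Lipschitz gradient. -/
def LocallyLipschitzDifferentiable (h : E → EReal) : Prop :=
  Differentiable ℝ (realVal h) ∧ LocallyLipschitz (grad h)

/-! ### The finite-sum problem and the algorithm -/

variable {N : ℕ}

/-- `C = ⋂ i, int dom h_i`. -/
def domC (h : Fin N → E → EReal) : Set E := ⋂ i, interior (effDom (h i))

/-- The cost `φ = (1/N) ∑ f_i + g`. -/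
def cost (f : Fin N → E → EReal) (g : E → EReal) (x : E) : EReal :=
  (((N : ℝ)⁻¹ : ℝ) : EReal) * (∑ i, f i x) + g x

/-- The objective of the inner minimization problem,
`w ↦ g(w) + ∑ (1/γ_i) h_i(w) - ⟨s, w⟩`. -/
def innerObj (h : Fin N → E → EReal) (g : E → EReal) (γ : Fin N → ℝ) (s w : E) : EReal :=
  g w + (∑ i, (((γ i)⁻¹ : ℝ) : EReal) * h i w) - ((inner ℝ s w : ℝ) : EReal)

/-- The set-valued map `T(s)` of minimizers of the inner problem. -/
def innerProx (h : Fin N → E → EReal) (g : E → EReal) (γ : Fin N → ℝ) (s : E) : Set E :=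
  argminOn (innerObj h g γ s) Set.univ

open Classical in
/-- `ĥ_i = h_i / γ_i - f_i / N`, with the convention `∞ - ∞ = ∞`. -/
def hatH (h f : Fin N → E → EReal) (γ : Fin N → ℝ) (i : Fin N) (x : E) : EReal :=
  if h i x = ⊤ then ⊤
  else (((γ i)⁻¹ : ℝ) : EReal) * h i x - (((N : ℝ)⁻¹ : ℝ) : EReal) * f i x

/-- The basic requirements on the problem and on the stepsizes `γ_i ∈ (0, N / L_i)`
(where `N / 0 = ∞`). -/
structure BasicAssumption (h f : Fin N → E → EReal) (g : E → EReal) (L γ : Fin N → ℝ) : Prop where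
  legendre : ∀ i, IsLegendre (h i)
  relSmooth : ∀ i, IsRelSmooth (L i) (f i) (h i)
  g_proper : IsProper g
  g_lsc : LowerSemicontinuous g
  argmin_nonempty : (argminOn (cost f g) (closure (domC h))).Nonempty
  stepsize_pos : ∀ i, 0 < γ i
  stepsize_lt : ∀ i, γ i * L i < N
  innerProx_subset : ∀ s : E, innerProx h g γ s ⊆ domC h

/-- `(1/γ_i) ∇h_i(x) - (1/N) ∇f_i(x)`. -/
def tableEntry (h f : Fin N → E → EReal) (γ : Fin N → ℝ) (i : Fin N) (x : E) : E :=
  (γ i)⁻¹ • grad (h i) x - (N : ℝ)⁻¹ • grad (f i) x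

/-- `z, s, s̃` are iterates generated by the Bregman Finito/MISO algorithm from the initial point
`xinit` with index sets `I 1, I 2, …` (`I 0` is not used). -/
structure IsBFinito (h f : Fin N → E → EReal) (g : E → EReal) (γ : Fin N → ℝ) (xinit : E)
    (I : ℕ → Finset (Fin N)) (z : ℕ → E) (s : ℕ → Fin N → E) (st : ℕ → E) : Prop where
  init_mem : xinit ∈ domC h
  s_zero : ∀ i, s 0 i = tableEntry h f γ i xinit
  st_zero : st 0 = ∑ i, s 0 i
  z_mem : ∀ k, z k ∈ innerProx h g γ (st k)
  s_succ_mem : ∀ k, ∀ i ∈ I (k + 1), s (k + 1) i = tableEntry h f γ i (z k)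
  s_succ_not_mem : ∀ k, ∀ i ∉ I (k + 1), s (k + 1) i = s k i
  st_succ : ∀ k, st (k + 1) = st k + ∑ i ∈ I (k + 1), (s (k + 1) i - s k i)

/-- The essentially cyclic rule: for some `T > 0`, every index is sampled at least once in any
`T` consecutive iterations. -/
def EssentiallyCyclic (I : ℕ → Finset (Fin N)) : Prop :=
  ∃ T : ℕ, 0 < T ∧ ∀ k : ℕ, (Finset.Icc 1 T).biUnion (fun t => I (k + t)) = Finset.univ

/-- The residual `D_{ĥ_i^*}(s_i, ∇ĥ_i(z))`. -/
def residual (h f : Fin N → E → EReal) (γ : Fin N → ℝ) (i : Fin N) (si z : E) : EReal :=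
  bregman (fenchelConj (hatH h f γ i)) si (grad (hatH h f γ i) z)

/-- The Lyapunov function `𝓛(z, s) = φ(z) + ∑ D_{ĥ_i^*}(s_i, ∇ĥ_i(z))`. -/
def lyapunov (h f : Fin N → E → EReal) (g : E → EReal) (γ : Fin N → ℝ) (z : E) (s : Fin N → E) :
    EReal :=
  cost f g z + ∑ i, residual h f γ i (s i) z

end

end BFinito

/-!
Every table entry of the algorithm is a gradient `s_i = ∇ĥ_i(y_i)`, where `y_i` (`refreshPoint`) is
the iterate at which the entry was last refreshed. By Fenchel duality the residual
`D_{ĥ_i^*}(s_i, ∇ĥ_i(z))` is then the primal Bregman distance `D_{ĥ_i}(z, y_i)`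
(`bregman_fenchelConj`), and, up to a constant, the inner problem is the minimization of the
majorant `w ↦ φ(w) + ∑ D_{ĥ_i}(w, y_i)`. Hence the Lyapunov function at `(z^k, s^k)` is the minimum
value of the majorant at iteration `k`.

Passing to the next table removes the Bregman distances of the refreshed entries from the value of
the majorant at `z^k`, and since `g` is convex the minimum at the next iteration lies below that
value by at least `∑ D_{h_i}(z^k, z^{k+1}) / γ_i` (`IsBFinito.descent`). Telescoping against the
lower bound of the cost makes these distances summable. The regularity of the kernels makes all
Bregman distances comparable with squared norms along the iterates: globally under strong convexity
and Lipschitz gradients, on a compact set containing the iterates when the cost is level bounded.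
So `‖z^{k+1} - z^k‖²` is summable. The essentially cyclic rule bounds the delays between `z^k` and
the `y_i^k` by `T`, so `‖z^k - y_i^k‖²` and the residuals are summable as well
(`IsBFinito.summable_residual`), and the cost has the same limit `φ_⋆` as the Lyapunov function.

At a limit point `z⋆` all `y_i^k` converge to `z⋆` along the subsequence. Comparing the minimum of
the majorant with its value at an arbitrary `w` and passing to the limit gives
`φ_⋆ ≤ φ(w) + ∑ C_i D_{h_i}(w, z⋆)`. The choice `w = z⋆` together with lower semicontinuity yields
`φ(z⋆) = φ_⋆`, and since `D_{h_i}(w, z⋆) = o(‖w - z⋆‖)` the inequality for all `w` is the stationarity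
of `z⋆` (`BasicAssumption.cost_eq_and_stationary`).

The summands `f_i` are not assumed differentiable. They are, because `L h_i ± f_i` are convex with
differentiable sum (`differentiableAt_of_add`), and then `|D_{f_i}| ≤ L D_{h_i}`, so that `D_{ĥ_i}`
is bounded from both sides by multiples of `D_{h_i}`.
-/

namespace BFinito

/-! ### Differentiable convex functions and their Bregman distances -/

section Real

variable {E : Type*} [NormedAddCommGroup E] [InnerProductSpace ℝ E] [CompleteSpace E]

/-- The Bregman distance of a finite-valued function, as a real number. -/
noncomputable def bregReal (F : E → ℝ) (x y : E) : ℝ :=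
  F x - F y - inner ℝ (gradient F y) (x - y)

theorem bregReal_self (F : E → ℝ) (x : E) : bregReal F x x = 0 := by
  simp [bregReal]

/-- First-order lower bounds along a segment pass to the directional derivative. -/
theorem le_inner_of_forall_mul_le {F : E → ℝ} {v y d : E} {c : ℝ} (hF : HasGradientAt F v y)
    (hc : ∀ t : ℝ, 0 < t → t ≤ 1 → t * c ≤ F (y + t • d) - F y) : c ≤ inner ℝ v d := by
  have hline : HasDerivAt (fun t : ℝ => y + t • d) d 0 := by
    simpa using ((hasDerivAt_id (0 : ℝ)).smul_const d).const_add y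
  have hF' : HasFDerivAt F (InnerProductSpace.toDual ℝ E v) (y + (0 : ℝ) • d) := by
    simpa using hF.hasFDerivAt
  have hcomp := (hF'.comp_hasDerivAt (0 : ℝ) hline).tendsto_slope_zero_right
  rw [InnerProductSpace.toDual_apply_apply] at hcomp
  refine ge_of_tendsto hcomp ?_
  filter_upwards [Ioc_mem_nhdsGT (zero_lt_one (α := ℝ))] with t ht
  have := hc t ht.1 ht.2
  simp only [Function.comp_apply, zero_add, zero_smul, add_zero, smul_eq_mul]
  rw [inv_mul_eq_div, le_div_iff₀ ht.1]
  linarith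

theorem add_inner_le_of_convexOn {F : E → ℝ} {S : Set E} (hF : ConvexOn ℝ S F) {x y v : E}
    (hx : x ∈ S) (hy : y ∈ S) (hv : HasGradientAt F v y) :
    F y + inner ℝ v (x - y) ≤ F x := by
  have hv' : HasGradientAt (fun w => -F w) (-v) y := by
    rw [hasGradientAt_iff_hasFDerivAt] at hv ⊢
    rw [map_neg]
    exact hv.neg
  have := le_inner_of_forall_mul_le (d := x - y) (c := F y - F x) hv' (by
    intro t ht0 ht1
    have h1 := hF.2 hy hx (sub_nonneg.2 ht1) ht0.le (by ring)
    have h2 : (1 - t) • y + t • x = y + t • (x - y) := by module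
    rw [h2] at h1
    simp only [smul_eq_mul] at h1
    linarith)
  rw [inner_neg_left] at this
  linarith

theorem bregReal_nonneg {F : E → ℝ} (hF : ConvexOn ℝ Set.univ F) {y : E}
    (hd : DifferentiableAt ℝ F y) (x : E) : 0 ≤ bregReal F x y := by
  have := add_inner_le_of_convexOn hF (Set.mem_univ x) (Set.mem_univ y) hd.hasGradientAt
  unfold bregReal
  linarith

theorem bregReal_le_inner {F : E → ℝ} (hF : ConvexOn ℝ Set.univ F) {x : E}
    (hd : DifferentiableAt ℝ F x) (y : E) :
    bregReal F x y ≤ inner ℝ (gradient F x - gradient F y) (x - y) := by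
  have := add_inner_le_of_convexOn hF (Set.mem_univ y) (Set.mem_univ x) hd.hasGradientAt
  rw [← neg_sub x y, inner_neg_right] at this
  rw [inner_sub_left]
  unfold bregReal
  linarith

theorem bregReal_le_of_lipschitzOnWith {F : E → ℝ} (hF : ConvexOn ℝ Set.univ F)
    (hd : Differentiable ℝ F) {K : NNReal} {S : Set E} (hL : LipschitzOnWith K (gradient F) S)
    {x y : E} (hx : x ∈ S) (hy : y ∈ S) : bregReal F x y ≤ K * ‖x - y‖ ^ 2 := by
  refine (bregReal_le_inner hF (hd x) y).trans ((real_inner_le_norm _ _).trans ?_)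
  rw [sq, ← mul_assoc]
  exact mul_le_mul_of_nonneg_right (hL.norm_sub_le hx hy) (norm_nonneg _)

theorem hasGradientAt_linear_comb {F G : E → ℝ} {x : E} (hF : DifferentiableAt ℝ F x)
    (hG : DifferentiableAt ℝ G x) (a b : ℝ) :
    HasGradientAt (fun w => a * F w + b * G w) (a • gradient F x + b • gradient G x) x := by
  rw [hasGradientAt_iff_hasFDerivAt]
  have := (hF.hasGradientAt.hasFDerivAt.const_mul a).add (hG.hasGradientAt.hasFDerivAt.const_mul b)
  rw [map_add, map_smul, map_smul]
  exact this

theorem bregReal_linear_comb {F G : E → ℝ} {y : E} (hF : DifferentiableAt ℝ F y)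
    (hG : DifferentiableAt ℝ G y) (a b : ℝ) (x : E) :
    bregReal (fun w => a * F w + b * G w) x y = a * bregReal F x y + b * bregReal G x y := by
  unfold bregReal
  rw [(hasGradientAt_linear_comb hF hG a b).gradient, inner_add_left, real_inner_smul_left,
    real_inner_smul_left]
  ring

theorem tendsto_bregReal {F : E → ℝ} (hF : Continuous F) (hG : Continuous (gradient F))
    {ι : Type*} {l : Filter ι} {u : ι → E} {y : E} (hu : Tendsto u l (𝓝 y)) (w : E) :
    Tendsto (fun k => bregReal F w (u k)) l (𝓝 (bregReal F w y)) := by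
  have hc : Continuous (fun y => bregReal F w y) := by
    unfold bregReal
    fun_prop
  exact (hc.tendsto y).comp hu

theorem bregReal_isLittleO {F : E → ℝ} {y : E} (hd : DifferentiableAt ℝ F y) :
    (fun x => bregReal F x y) =o[𝓝 y] fun x => x - y :=
  hasGradientAt_iff_isLittleO.1 hd.hasGradientAt

/-- By the Hahn-Banach theorem applied to the strict epigraph, a finite-valued convex function on
a finite-dimensional space has a subgradient at every point. -/
theorem exists_subgradient [FiniteDimensional ℝ E] {P : E → ℝ} (hP : ConvexOn ℝ Set.univ P)
    (y : E) : ∃ v : E, ∀ x, P y + inner ℝ v (x - y) ≤ P x := by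
  have hcont : Continuous P := hP.locallyLipschitz.continuous
  have hconv := hP.convex_strict_epigraph
  have hopen : IsOpen {p : E × ℝ | p.1 ∈ Set.univ ∧ P p.1 < p.2} := by
    simpa using isOpen_lt (hcont.comp continuous_fst) continuous_snd
  obtain ⟨φ, hφ⟩ := geometric_hahn_banach_open_point hconv hopen (x := (y, P y)) (by simp)
  have hsplit : ∀ (x : E) (t : ℝ), φ (x, t) = φ (x, 0) + t * φ (0, 1) := by
    intro x t
    rw [← smul_eq_mul, ← map_smul, ← map_add]
    simp
  set c := φ (0, 1) with hc
  have hcneg : c < 0 := by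
    have := hφ (y, P y + 1) (by simp)
    rw [hsplit y, hsplit y (P y)] at this
    linarith
  let l : StrongDual ℝ E := φ.comp (ContinuousLinearMap.inl ℝ E ℝ)
  refine ⟨(-c⁻¹) • (InnerProductSpace.toDual ℝ E).symm l, fun x => ?_⟩
  have hl : inner ℝ ((InnerProductSpace.toDual ℝ E).symm l) (x - y) = φ (x, 0) - φ (y, 0) := by
    rw [InnerProductSpace.toDual_symm_apply, map_sub]
    simp [l]
  rw [real_inner_smul_left, hl]
  refine le_of_forall_pos_lt_add fun ε hε => ?_
  have := hφ (x, P x + ε) (by simpa using hε)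
  rw [hsplit x, hsplit y (P y)] at this
  have h1 : φ (x, 0) - φ (y, 0) < (-c) * (P x + ε - P y) := by linarith
  have h2 : (-c⁻¹) * (φ (x, 0) - φ (y, 0)) < P x + ε - P y := by
    have := mul_lt_mul_of_pos_left h1 (show 0 < -c⁻¹ from by simpa using hcneg)
    have hcc : (-c⁻¹) * ((-c) * (P x + ε - P y)) = P x + ε - P y := by
      rw [← mul_assoc, neg_mul_neg, inv_mul_cancel₀ hcneg.ne, one_mul]
    linarith
  linarith

/-- If a sum of two convex functions is differentiable at a point, so is each summand: the two
remainders with respect to subgradients are nonnegative and their sum is `o(‖x - y‖)`. -/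
theorem differentiableAt_of_add [FiniteDimensional ℝ E] {P Q : E → ℝ}
    (hP : ConvexOn ℝ Set.univ P) (hQ : ConvexOn ℝ Set.univ Q) {y : E}
    (hd : DifferentiableAt ℝ (fun x => P x + Q x) y) : DifferentiableAt ℝ P y := by
  obtain ⟨p, hp⟩ := exists_subgradient hP y
  obtain ⟨q, hq⟩ := exists_subgradient hQ y
  have hv := hd.hasGradientAt
  set v := gradient (fun x => P x + Q x) y
  have hpq : p + q = v := by
    have key : ∀ d : E, inner ℝ (p + q) d ≤ inner ℝ v d := fun d =>
      le_inner_of_forall_mul_le hv fun t ht _ => by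
        have h1 := hp (y + t • d)
        have h2 := hq (y + t • d)
        rw [add_sub_cancel_left, real_inner_smul_right] at h1 h2
        rw [inner_add_left]
        linarith
    have := key (p + q - v)
    rw [← sub_nonpos, ← inner_sub_left, real_inner_self_nonpos, sub_eq_zero] at this
    exact this
  have ho := hasGradientAt_iff_isLittleO.1 hv
  have : HasGradientAt P p y := by
    refine hasGradientAt_iff_isLittleO.2 (Asymptotics.IsBigO.trans_isLittleO ?_ ho)
    refine Asymptotics.IsBigO.of_bound' (Eventually.of_forall fun x => ?_)
    have h1 := hp x
    have h2 := hq x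
    rw [← hpq, inner_add_left, Real.norm_of_nonneg (by linarith), Real.norm_of_nonneg (by linarith)]
    linarith
  exact this.differentiableAt

theorem bregReal_ge_of_strongConvexOn {F : E → ℝ} {U : Set E} {μ : ℝ}
    (hF : StrongConvexOn U μ F) {x y : E} (hx : x ∈ U) (hy : y ∈ U)
    (hd : DifferentiableAt ℝ F y) : μ / 2 * ‖x - y‖ ^ 2 ≤ bregReal F x y := by
  have hG : HasGradientAt (fun w => F w - μ / 2 * ‖w‖ ^ 2) (gradient F y - μ • y) y := by
    rw [hasGradientAt_iff_hasFDerivAt]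
    refine (hd.hasGradientAt.hasFDerivAt.sub
      ((hasStrictFDerivAt_norm_sq y).hasFDerivAt.const_mul (μ / 2))).congr_fderiv ?_
    ext w
    simp
    ring
  have := add_inner_le_of_convexOn (strongConvexOn_iff_convex.1 hF) hx hy hG
  rw [inner_sub_left, real_inner_smul_left, inner_sub_right y, real_inner_self_eq_norm_sq] at this
  rw [norm_sub_sq_real, real_inner_comm]
  unfold bregReal
  linarith

theorem bregReal_segment_le {F : E → ℝ} (hF : ConvexOn ℝ Set.univ F) (x y : E) {t : ℝ}
    (ht0 : 0 ≤ t) (ht1 : t ≤ 1) : bregReal F (y + t • (x - y)) y ≤ t * bregReal F x y := by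
  have h1 := hF.2 (Set.mem_univ y) (Set.mem_univ x) (sub_nonneg.2 ht1) ht0 (by ring)
  have h2 : (1 - t) • y + t • x = y + t • (x - y) := by module
  rw [h2] at h1
  simp only [smul_eq_mul] at h1
  unfold bregReal
  rw [add_sub_cancel_left, real_inner_smul_right]
  linarith

/-- Strong convexity near a point, propagated to the whole space along rays: the growth is
quadratic up to distance `ε` and linear beyond. -/
theorem bregReal_growth_of_strongConvexOn {F : E → ℝ} (hF : ConvexOn ℝ Set.univ F)
    (hd : Differentiable ℝ F) {U : Set E} {μ : ℝ} (hU : StrongConvexOn U μ F) {p : E} {ε : ℝ}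
    (hε : 0 < ε) (hball : Metric.ball p (2 * ε) ⊆ U) {y : E} (hy : y ∈ Metric.ball p ε) (x : E) :
    μ / 2 * (‖x - y‖ * min ‖x - y‖ ε) ≤ bregReal F x y := by
  rw [Metric.mem_ball] at hy
  have hyU : y ∈ U := hball (Metric.mem_ball.2 (by linarith))
  have hmem : ∀ w : E, ‖w - y‖ ≤ ε → w ∈ U := fun w hw => hball (Metric.mem_ball.2 (by
    have := dist_triangle w y p
    rw [dist_eq_norm w y] at this
    linarith))
  rcases le_total ‖x - y‖ ε with h | h
  · rw [min_eq_left h, ← sq]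
    exact bregReal_ge_of_strongConvexOn hU (hmem x h) hyU (hd y)
  · rw [min_eq_right h]
    have hr : 0 < ‖x - y‖ := hε.trans_le h
    have ht1 : ε / ‖x - y‖ ≤ 1 := (div_le_one hr).2 h
    have hseg := bregReal_segment_le hF x y (div_pos hε hr).le ht1
    have hn : ‖y + (ε / ‖x - y‖) • (x - y) - y‖ = ε := by
      rw [add_sub_cancel_left, norm_smul, Real.norm_of_nonneg (div_pos hε hr).le,
        div_mul_cancel₀ _ hr.ne']
    have hlow := bregReal_ge_of_strongConvexOn hU (hmem _ hn.le) hyU (hd y)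
    rw [hn] at hlow
    have := hlow.trans hseg
    rw [div_mul_eq_mul_div (a := ε), le_div_iff₀ hr] at this
    refine le_of_mul_le_mul_left ?_ hε
    linarith

/-- A locally strongly convex function satisfies a uniform growth estimate at all base points of
a compact set. -/
theorem exists_bregReal_growth {h : E → EReal} (hF : ConvexOn ℝ Set.univ (realVal h))
    (hd : Differentiable ℝ (realVal h)) (hs : LocallyStronglyConvex h) {S : Set E}
    (hS : IsCompact S) : ∃ a > 0, ∃ δ > 0, ∀ y ∈ S, ∀ x,
      a * (‖x - y‖ * min ‖x - y‖ δ) ≤ bregReal (realVal h) x y := by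
  refine hS.induction_on (p := fun S => ∃ a > 0, ∃ δ > 0, ∀ y ∈ S, ∀ x,
      a * (‖x - y‖ * min ‖x - y‖ δ) ≤ bregReal (realVal h) x y) ?_ ?_ ?_ ?_
  · exact ⟨1, one_pos, 1, one_pos, by simp⟩
  · intro S T hST hT
    obtain ⟨a, ha, δ, hδ, H⟩ := hT
    exact ⟨a, ha, δ, hδ, fun y hy => H y (hST hy)⟩
  · intro S T hS hT
    obtain ⟨a, ha, δ, hδ, H⟩ := hS
    obtain ⟨b, hb, η, hη, H'⟩ := hT
    refine ⟨min a b, lt_min ha hb, min δ η, lt_min hδ hη, fun y hy x => ?_⟩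
    rcases hy with hy | hy
    · refine le_trans ?_ (H y hy x)
      gcongr
      · exact min_le_left _ _
      · exact min_le_left _ _
    · refine le_trans ?_ (H' y hy x)
      gcongr
      · exact min_le_right _ _
      · exact min_le_right _ _
  · intro p _
    obtain ⟨U, hU, μ, hμ, hsc⟩ := hs p
    obtain ⟨ε, hε, hball⟩ := Metric.mem_nhds_iff.1 hU
    refine ⟨Metric.ball p (ε / 2), mem_nhdsWithin_of_mem_nhds (Metric.ball_mem_nhds p (half_pos hε)),
      μ / 2, half_pos hμ, ε / 2, half_pos hε, fun y hy x => ?_⟩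
    exact bregReal_growth_of_strongConvexOn hF hd hsc (half_pos hε)
      (by rwa [mul_div_cancel₀ _ two_ne_zero]) hy x

end Real

/-! ### Conjugates -/

section Conjugate

variable {E : Type*} [NormedAddCommGroup E] [InnerProductSpace ℝ E]

theorem coe_le_fenchelConj (F : E → ℝ) (v z : E) :
    ((inner ℝ v z - F z : ℝ) : EReal) ≤ fenchelConj (fun x => (F x : EReal)) v := by
  rw [EReal.coe_sub]
  exact le_iSup (fun x : E => ((inner ℝ v x : ℝ) : EReal) - (F x : EReal)) z

theorem fenchelConj_le_coe {F : E → ℝ} {v : E} {c : ℝ} (hc : ∀ x, inner ℝ v x - F x ≤ c) :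
    fenchelConj (fun x => (F x : EReal)) v ≤ (c : EReal) := by
  refine iSup_le fun x => ?_
  rw [← EReal.coe_sub, EReal.coe_le_coe_iff]
  exact hc x

/-- The equality case of the Fenchel-Young inequality. -/
theorem fenchelConj_eq_of_subgradient {F : E → ℝ} {v z : E}
    (hv : ∀ x, F z + inner ℝ v (x - z) ≤ F x) :
    fenchelConj (fun x => (F x : EReal)) v = ((inner ℝ v z - F z : ℝ) : EReal) := by
  refine le_antisymm (fenchelConj_le_coe fun x => ?_) (coe_le_fenchelConj F v z)
  have := hv x
  rw [inner_sub_right] at this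
  linarith

/-- If `F` grows away from `z` relative to the affine function with slope `v`, quadratically near
`z` and linearly beyond, then the conjugate stays within a quadratic of its tangent at `v`. -/
theorem fenchelConj_le_of_growth {F : E → ℝ} {v z : E} {a δ : ℝ} (ha : 0 < a)
    (hF : ∀ x, a * (‖x - z‖ * min ‖x - z‖ δ) ≤ F x - F z - inner ℝ v (x - z)) {w : E}
    (hw : ‖w - v‖ ≤ a * δ) :
    fenchelConj (fun x => (F x : EReal)) w ≤
      ((inner ℝ w z - F z + ‖w - v‖ ^ 2 / (4 * a) : ℝ) : EReal) := by
  refine fenchelConj_le_coe fun x => ?_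
  have h1 := hF x
  have h2 : inner ℝ (w - v) (x - z) ≤ ‖w - v‖ * ‖x - z‖ := real_inner_le_norm _ _
  rw [inner_sub_left, inner_sub_right w] at h2
  suffices ‖w - v‖ * ‖x - z‖ - a * (‖x - z‖ * min ‖x - z‖ δ) ≤ ‖w - v‖ ^ 2 / (4 * a) by linarith
  rcases le_total ‖x - z‖ δ with h | h
  · rw [min_eq_left h, le_div_iff₀ (by positivity)]
    nlinarith [sq_nonneg (‖w - v‖ - 2 * a * ‖x - z‖)]
  · rw [min_eq_right h]
    have : ‖w - v‖ * ‖x - z‖ ≤ a * δ * ‖x - z‖ :=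
      mul_le_mul_of_nonneg_right hw (norm_nonneg _)
    have : 0 ≤ ‖w - v‖ ^ 2 / (4 * a) := by positivity
    linarith

/-- The Bregman distance of the conjugate between two gradients is the Bregman distance of the
function with the arguments exchanged. Only growth at the point `z` is needed for the conjugate to
be differentiable at `∇F(z)`. -/
theorem bregman_fenchelConj [CompleteSpace E] {F : E → ℝ} (hF : ConvexOn ℝ Set.univ F) (hd : Differentiable ℝ F)
    {y z : E} {a δ : ℝ} (ha : 0 < a) (hδ : 0 < δ)
    (hgrow : ∀ x, a * (‖x - z‖ * min ‖x - z‖ δ) ≤ bregReal F x z) :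
    bregman (fenchelConj fun x => (F x : EReal)) (gradient F y) (gradient F z) =
      (bregReal F z y : EReal) := by
  set v := gradient F z
  have hsub : ∀ y x, F y + inner ℝ (gradient F y) (x - y) ≤ F x := fun y x =>
    add_inner_le_of_convexOn hF (Set.mem_univ _) (Set.mem_univ _) (hd y).hasGradientAt
  have hz : fenchelConj (fun x => (F x : EReal)) v = ((inner ℝ v z - F z : ℝ) : EReal) :=
    fenchelConj_eq_of_subgradient (hsub z)
  have hy := fenchelConj_eq_of_subgradient (hsub y)
  have hnear : ∀ᶠ w in 𝓝 v, ‖w - v‖ ≤ a * δ := by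
    filter_upwards [Metric.closedBall_mem_nhds v (mul_pos ha hδ)] with w hw
    simpa [dist_eq_norm] using hw
  have hup : ∀ᶠ w in 𝓝 v, fenchelConj (fun x => (F x : EReal)) w ≤
      ((inner ℝ w z - F z + ‖w - v‖ ^ 2 / (4 * a) : ℝ) : EReal) :=
    hnear.mono fun w hw => fenchelConj_le_of_growth ha hgrow hw
  have hint : v ∈ interior (effDom (fenchelConj fun x => (F x : EReal))) := by
    rw [mem_interior_iff_mem_nhds]
    filter_upwards [hup] with w hw
    exact hw.trans_lt (EReal.coe_lt_top _)
  have hgrad : HasGradientAt (realVal (fenchelConj fun x => (F x : EReal))) z v := by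
    refine hasGradientAt_iff_isLittleO.2 ?_
    have hquad : (fun w => ‖w - v‖ ^ 2) =o[𝓝 v] fun w => w - v := by
      have := (Asymptotics.isLittleO_norm_pow_id (E' := E) one_lt_two).comp_tendsto
        (show Tendsto (fun w => w - v) (𝓝 v) (𝓝 0) from
          tendsto_sub_nhds_zero_iff.2 tendsto_id)
      exact this
    refine Asymptotics.IsBigO.trans_isLittleO ?_ hquad
    refine Asymptotics.IsBigO.of_bound (1 / (4 * a)) ?_
    filter_upwards [hup] with w hw
    have hlow := coe_le_fenchelConj F w z
    obtain ⟨r, hr⟩ : ∃ r : ℝ, fenchelConj (fun x => (F x : EReal)) w = (r : EReal) := by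
      refine ⟨_, (EReal.coe_toReal (hw.trans_lt (EReal.coe_lt_top _)).ne ?_).symm⟩
      exact ((EReal.bot_lt_coe _).trans_le hlow).ne'
    rw [hr, EReal.coe_le_coe_iff] at hw hlow
    simp only [realVal]
    have hcomm : inner ℝ z (w - v) = inner ℝ w z - inner ℝ v z := by
      rw [real_inner_comm, inner_sub_left]
    rw [hz, hr, EReal.toReal_coe, EReal.toReal_coe, hcomm, Real.norm_of_nonneg (by linarith),
      Real.norm_of_nonneg (by positivity)]
    have : 1 / (4 * a) * ‖w - v‖ ^ 2 = ‖w - v‖ ^ 2 / (4 * a) := by ring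
    linarith
  unfold bregman
  rw [if_pos hint, hz, hy, grad, hgrad.gradient, ← EReal.coe_sub, ← EReal.coe_sub,
    EReal.coe_eq_coe_iff]
  unfold bregReal
  simp only [inner_sub_right, real_inner_comm z]
  ring

end Conjugate

/-! ### Finite-valued descriptions of the data -/

section Domain

variable {E : Type*} [NormedAddCommGroup E]

theorem coe_realVal {E : Type*} {F : E → EReal} (hF : IsProper F) {x : E} (hx : F x < ⊤) :
    F x = (realVal F x : EReal) :=
  (EReal.coe_toReal hx.ne (hF.1 x)).symm

theorem effDom_eq_univ_of_domC {N : ℕ} {h : Fin N → E → EReal} (hC : domC h = Set.univ) (i : Fin N) :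
    effDom (h i) = Set.univ := by
  refine Set.eq_univ_of_univ_subset (hC ▸ ?_)
  exact (Set.iInter_subset _ i).trans interior_subset

theorem realVal_segment_le [InnerProductSpace ℝ E] {g : E → EReal} (hg : IsConvexFun g) (hp : IsProper g) {z w : E} (hz : g z < ⊤)
    (hw : g w < ⊤) {t : ℝ} (ht0 : 0 ≤ t) (ht1 : t ≤ 1) :
    g (z + t • (w - z)) < ⊤ ∧
      realVal g (z + t • (w - z)) ≤ realVal g z + t * (realVal g w - realVal g z) := by
  have hmem := hg (x := (z, realVal g z)) (y := (w, realVal g w))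
    (by simp [← coe_realVal hp hz]) (by simp [← coe_realVal hp hw]) (sub_nonneg.2 ht1) ht0 (by ring)
  have hpt : (1 - t) • z + t • w = z + t • (w - z) := by module
  simp only [Prod.smul_mk, Prod.mk_add_mk, Set.mem_ofPred_eq, hpt, smul_eq_mul] at hmem
  have hlt := hmem.trans_lt (EReal.coe_lt_top _)
  refine ⟨hlt, ?_⟩
  rw [coe_realVal hp hlt, EReal.coe_le_coe_iff] at hmem
  linarith

end Domain

section Model

variable {E : Type*} [NormedAddCommGroup E] [InnerProductSpace ℝ E] [CompleteSpace E]
variable {N : ℕ} {h f : Fin N → E → EReal} {g : E → EReal} {L γ : Fin N → ℝ}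

/-- The finite-valued version of `ĥ_i`. -/
noncomputable def hatReal (h f : Fin N → E → EReal) (γ : Fin N → ℝ) (i : Fin N) (x : E) : ℝ :=
  (γ i)⁻¹ * realVal (h i) x + (-(N : ℝ)⁻¹) * realVal (f i) x

namespace BasicAssumption

theorem upper_const_nonneg (hb : BasicAssumption h f g L γ) (i : Fin N) :
    0 ≤ (γ i)⁻¹ + L i / N := by
  have := hb.stepsize_pos i
  have := (hb.relSmooth i).modulus_nonneg
  positivity

variable (hb : BasicAssumption h f g L γ) (hC : domC h = Set.univ)
include hb hC

theorem coe_kernel (i : Fin N) (x : E) : h i x = (realVal (h i) x : EReal) :=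
  coe_realVal (hb.legendre i).proper (by
    have : x ∈ effDom (h i) := by rw [effDom_eq_univ_of_domC hC i]; trivial
    exact this)

theorem coe_summand (i : Fin N) (x : E) : f i x = (realVal (f i) x : EReal) :=
  coe_realVal (hb.relSmooth i).proper ((hb.relSmooth i).dom_subset (by
    rw [effDom_eq_univ_of_domC hC i]; trivial))

theorem convexOn_kernel (i : Fin N) : ConvexOn ℝ Set.univ (realVal (h i)) := by
  have := (hb.legendre i).strictConvex.convexOn
  rwa [effDom_eq_univ_of_domC hC i] at this

theorem contDiff_kernel (i : Fin N) : ContDiff ℝ 1 (realVal (h i)) := by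
  have := (hb.legendre i).contDiffOn
  rwa [effDom_eq_univ_of_domC hC i, interior_univ, contDiffOn_univ] at this

theorem differentiable_kernel (i : Fin N) : Differentiable ℝ (realVal (h i)) :=
  (hb.contDiff_kernel hC i).differentiable one_ne_zero

theorem continuous_gradient_kernel (i : Fin N) : Continuous (gradient (realVal (h i))) :=
  (InnerProductSpace.toDual ℝ E).symm.continuous.comp
    ((hb.contDiff_kernel hC i).continuous_fderiv one_ne_zero)

theorem convexOn_add (i : Fin N) :
    ConvexOn ℝ Set.univ (fun x => L i * realVal (h i) x + realVal (f i) x) := by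
  have := (hb.relSmooth i).convex_add
  rwa [effDom_eq_univ_of_domC hC i, interior_univ] at this

theorem convexOn_sub (i : Fin N) :
    ConvexOn ℝ Set.univ (fun x => L i * realVal (h i) x - realVal (f i) x) := by
  have := (hb.relSmooth i).convex_sub
  rwa [effDom_eq_univ_of_domC hC i, interior_univ] at this

/-- Relative smoothness transfers differentiability from `h_i` to `f_i`: the functions
`L h_i ± f_i` are convex and have a differentiable sum. -/
theorem differentiable_summand [FiniteDimensional ℝ E] (i : Fin N) :
    Differentiable ℝ (realVal (f i)) := by
  intro y
  have hd := hb.differentiable_kernel hC i y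
  have h1 := differentiableAt_of_add (hb.convexOn_add hC i) (hb.convexOn_sub hC i) (y := y) (by
    have : (fun x => L i * realVal (h i) x + realVal (f i) x +
        (L i * realVal (h i) x - realVal (f i) x)) = fun x => 2 * L i * realVal (h i) x := by
      ext x; ring
    rw [this]
    exact hd.const_mul _)
  have h2 := h1.sub (hd.const_mul (L i))
  have h3 : realVal (f i) =
      (fun x => L i * realVal (h i) x + realVal (f i) x) - fun x => L i * realVal (h i) x := by
    ext x
    simp
  rw [h3]
  exact h2

theorem abs_bregReal_summand_le [FiniteDimensional ℝ E] (i : Fin N) (x y : E) :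
    |bregReal (realVal (f i)) x y| ≤ L i * bregReal (realVal (h i)) x y := by
  have hdh := hb.differentiable_kernel hC i y
  have hdf := hb.differentiable_summand hC i y
  have h1 := bregReal_linear_comb hdh hdf (L i) 1 x
  have h2 := bregReal_linear_comb hdh hdf (L i) (-1) x
  have h3 := bregReal_nonneg (hb.convexOn_add hC i) (y := y) ((hdh.const_mul _).add hdf) x
  have h4 := bregReal_nonneg (hb.convexOn_sub hC i) (y := y) ((hdh.const_mul _).sub hdf) x
  simp only [one_mul, neg_mul, ← sub_eq_add_neg] at h1 h2
  rw [abs_le]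
  constructor <;> linarith

theorem hatH_eq (i : Fin N) : hatH h f γ i = fun x => (hatReal h f γ i x : EReal) := by
  ext x
  unfold hatH hatReal
  rw [hb.coe_kernel hC i x, hb.coe_summand hC i x, if_neg (EReal.coe_ne_top _), ← EReal.coe_mul,
    ← EReal.coe_mul, ← EReal.coe_sub, neg_mul, sub_eq_add_neg]

theorem differentiable_hatReal [FiniteDimensional ℝ E] (i : Fin N) :
    Differentiable ℝ (hatReal h f γ i) :=
  ((hb.differentiable_kernel hC i).const_mul _).add ((hb.differentiable_summand hC i).const_mul _)

theorem gradient_hatReal [FiniteDimensional ℝ E] (i : Fin N) (x : E) :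
    gradient (hatReal h f γ i) x = tableEntry h f γ i x := by
  have := (hasGradientAt_linear_comb (hb.differentiable_kernel hC i x)
    (hb.differentiable_summand hC i x) (γ i)⁻¹ (-(N : ℝ)⁻¹)).gradient
  rw [neg_smul, ← sub_eq_add_neg] at this
  exact this

theorem convexOn_hatReal (hN : 0 < N) (i : Fin N) :
    ConvexOn ℝ Set.univ (hatReal h f γ i) := by
  have hN' : (0 : ℝ) < N := Nat.cast_pos.2 hN
  have hγ := hb.stepsize_pos i
  have hpos : 0 ≤ (γ i)⁻¹ - L i / N := by
    rw [sub_nonneg, ← one_div, div_le_div_iff₀ hN' hγ]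
    linarith [hb.stepsize_lt i]
  have := ((hb.convexOn_kernel hC i).smul hpos).add
    ((hb.convexOn_sub hC i).smul (inv_nonneg.2 hN'.le))
  have heq : hatReal h f γ i = (fun x => ((γ i)⁻¹ - L i / N) • realVal (h i) x) +
      fun x => (N : ℝ)⁻¹ • (L i * realVal (h i) x - realVal (f i) x) := by
    ext x
    simp only [hatReal, Pi.add_apply, smul_eq_mul]
    ring
  rw [heq]
  exact this

theorem bregReal_hatReal [FiniteDimensional ℝ E] (i : Fin N) (x y : E) :
    bregReal (hatReal h f γ i) x y =
      (γ i)⁻¹ * bregReal (realVal (h i)) x y - (N : ℝ)⁻¹ * bregReal (realVal (f i)) x y := by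
  have := bregReal_linear_comb (hb.differentiable_kernel hC i y)
    (hb.differentiable_summand hC i y) (γ i)⁻¹ (-(N : ℝ)⁻¹) x
  rw [neg_mul, ← sub_eq_add_neg] at this
  exact this

theorem le_bregReal_hatReal [FiniteDimensional ℝ E] (i : Fin N) (x y : E) :
    ((γ i)⁻¹ - L i / N) * bregReal (realVal (h i)) x y ≤ bregReal (hatReal h f γ i) x y := by
  have h1 := (abs_le.1 (hb.abs_bregReal_summand_le hC i x y)).2
  have h2 : (N : ℝ)⁻¹ * bregReal (realVal (f i)) x y ≤
      (N : ℝ)⁻¹ * (L i * bregReal (realVal (h i)) x y) :=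
    mul_le_mul_of_nonneg_left h1 (by positivity)
  rw [hb.bregReal_hatReal hC, div_eq_inv_mul, sub_mul, mul_assoc]
  linarith

theorem bregReal_hatReal_le [FiniteDimensional ℝ E] (i : Fin N) (x y : E) :
    bregReal (hatReal h f γ i) x y ≤ ((γ i)⁻¹ + L i / N) * bregReal (realVal (h i)) x y := by
  have h1 := (abs_le.1 (hb.abs_bregReal_summand_le hC i x y)).1
  have h2 : (N : ℝ)⁻¹ * (-(L i * bregReal (realVal (h i)) x y)) ≤
      (N : ℝ)⁻¹ * bregReal (realVal (f i)) x y :=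
    mul_le_mul_of_nonneg_left h1 (by positivity)
  rw [hb.bregReal_hatReal hC, div_eq_inv_mul, add_mul, mul_assoc]
  linarith

theorem bregReal_hatReal_nonneg [FiniteDimensional ℝ E] (hN : 0 < N) (i : Fin N) (x y : E) :
    0 ≤ bregReal (hatReal h f γ i) x y :=
  bregReal_nonneg (hb.convexOn_hatReal hC hN i) (hb.differentiable_hatReal hC i y) x

/-- At a table entry `∇ĥ_i(y)`, the residual is the Bregman distance `D_{ĥ_i}(z, y)`. -/
theorem residual_tableEntry [FiniteDimensional ℝ E] (hN : 0 < N) {i : Fin N}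
    (hs : LocallyStronglyConvex (h i)) (y z : E) :
    residual h f γ i (tableEntry h f γ i y) z = (bregReal (hatReal h f γ i) z y : EReal) := by
  obtain ⟨a, ha, δ, hδ, hgrow⟩ := exists_bregReal_growth (hb.convexOn_kernel hC i)
    (hb.differentiable_kernel hC i) hs (isCompact_singleton (x := z))
  have hN' : (0 : ℝ) < N := Nat.cast_pos.2 hN
  have hpos : 0 < (γ i)⁻¹ - L i / N := by
    rw [sub_pos, ← one_div, div_lt_div_iff₀ hN' (hb.stepsize_pos i)]
    linarith [hb.stepsize_lt i]
  have hgrad : grad (hatH h f γ i) z = gradient (hatReal h f γ i) z := by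
    rw [grad, hb.hatH_eq hC i]
    rfl
  unfold residual
  rw [hgrad, hb.hatH_eq hC i, ← hb.gradient_hatReal hC]
  refine bregman_fenchelConj (hb.convexOn_hatReal hC hN i) (hb.differentiable_hatReal hC i)
    (mul_pos hpos ha) hδ fun x => le_trans ?_ (hb.le_bregReal_hatReal hC i x z)
  rw [mul_assoc]
  exact mul_le_mul_of_nonneg_left (hgrow z rfl x) hpos.le

theorem cost_eq (x : E) :
    cost f g x = (((N : ℝ)⁻¹ * ∑ i, realVal (f i) x : ℝ) : EReal) + g x := by
  unfold cost
  simp_rw [fun i => hb.coe_summand hC i x]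
  rw [EReal.coe_mul]
  congr 2
  exact (map_sum (⟨⟨Real.toEReal, rfl⟩, EReal.coe_add⟩ : ℝ →+ EReal) _ _).symm

theorem innerObj_eq (s w : E) :
    innerObj h g γ s w =
      g w + ((∑ i, (γ i)⁻¹ * realVal (h i) w - inner ℝ s w : ℝ) : EReal) := by
  unfold innerObj
  simp_rw [fun i => hb.coe_kernel hC i w, ← EReal.coe_mul]
  rw [EReal.coe_sub, sub_eq_add_neg, sub_eq_add_neg, add_assoc]
  congr 2
  exact (map_sum (⟨⟨Real.toEReal, rfl⟩, EReal.coe_add⟩ : ℝ →+ EReal) _ _).symm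

theorem lt_top_of_mem_innerProx {s z : E} (hz : z ∈ innerProx h g γ s) : g z < ⊤ := by
  have := hz.2.1
  rw [hb.innerObj_eq hC] at this
  refine lt_top_iff_ne_top.2 fun htop => ?_
  rw [htop, EReal.top_add_coe] at this
  exact this.false

theorem innerProx_le {s z : E} (hz : z ∈ innerProx h g γ s) {w : E} (hw : g w < ⊤) :
    realVal g z + (∑ i, (γ i)⁻¹ * realVal (h i) z - inner ℝ s z) ≤
      realVal g w + (∑ i, (γ i)⁻¹ * realVal (h i) w - inner ℝ s w) := by
  have := hz.2.2 w (Set.mem_univ w)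
  rwa [hb.innerObj_eq hC, hb.innerObj_eq hC, coe_realVal hb.g_proper hw,
    coe_realVal hb.g_proper (hb.lt_top_of_mem_innerProx hC hz), ← EReal.coe_add, ← EReal.coe_add,
    EReal.coe_le_coe_iff] at this

end BasicAssumption

/-- Three-point inequality for the inner minimization problem: convexity of `g` improves the
minimality of `z` by the Bregman distances of the kernels. -/
theorem BasicAssumption.innerProx_add_bregReal_le (hb : BasicAssumption h f g L γ)
    (hC : domC h = Set.univ) (hg : IsConvexFun g) {s z : E} (hz : z ∈ innerProx h g γ s)
    {w : E} (hw : g w < ⊤) :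
    realVal g z + (∑ i, (γ i)⁻¹ * realVal (h i) z - inner ℝ s z) +
        ∑ i, (γ i)⁻¹ * bregReal (realVal (h i)) w z ≤
      realVal g w + (∑ i, (γ i)⁻¹ * realVal (h i) w - inner ℝ s w) := by
  have hgz := hb.lt_top_of_mem_innerProx hC hz
  have hgrad : HasGradientAt (fun x => ∑ i, (γ i)⁻¹ * realVal (h i) x)
      (∑ i, (γ i)⁻¹ • gradient (realVal (h i)) z) z := by
    rw [hasGradientAt_iff_hasFDerivAt, map_sum]
    refine HasFDerivAt.fun_sum fun i _ => ?_
    rw [map_smul]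
    exact ((hb.differentiable_kernel hC i z).hasGradientAt.hasFDerivAt).const_mul _
  have key := le_inner_of_forall_mul_le (d := w - z)
    (c := inner ℝ s (w - z) - (realVal g w - realVal g z)) hgrad (by
      intro t ht0 ht1
      obtain ⟨hlt, hle⟩ := realVal_segment_le hg hb.g_proper hgz hw ht0.le ht1
      have := hb.innerProx_le hC hz hlt
      rw [inner_add_right, real_inner_smul_right] at this
      linarith)
  have hsum : ∑ i, (γ i)⁻¹ * bregReal (realVal (h i)) w z =
      ∑ i, (γ i)⁻¹ * realVal (h i) w - ∑ i, (γ i)⁻¹ * realVal (h i) z -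
        inner ℝ (∑ i, (γ i)⁻¹ • gradient (realVal (h i)) z) (w - z) := by
    rw [sum_inner, ← Finset.sum_sub_distrib, ← Finset.sum_sub_distrib]
    refine Finset.sum_congr rfl fun i _ => ?_
    rw [real_inner_smul_left]
    unfold bregReal
    ring
  rw [inner_sub_right s] at key
  linarith

end Model

/-! ### Sequences with bounded delays -/

section Sequences

theorem summable_of_descent {Λ a : ℕ → ℝ} {m : ℝ} (ha : ∀ k, 0 ≤ a k)
    (hdesc : ∀ k, Λ (k + 1) + a k ≤ Λ k) (hm : ∀ k, m ≤ Λ k) : Summable a := by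
  refine summable_of_sum_range_le (c := Λ 0 - m) ha fun n => ?_
  have : ∑ i ∈ Finset.range n, a i ≤ Λ 0 - Λ n := by
    rw [← Finset.sum_range_sub' Λ n]
    exact Finset.sum_le_sum fun i _ => by linarith [hdesc i]
  linarith [hm n]

theorem sq_norm_sub_le_of_window {E : Type*} [NormedAddCommGroup E] (u : ℕ → E) {k l T : ℕ}
    (hkl : k ≤ l) (hlT : l ≤ k + T) :
    ‖u (k + T) - u l‖ ^ 2 ≤ T * ∑ j ∈ Finset.range T, ‖u (k + j + 1) - u (k + j)‖ ^ 2 := by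
  have h1 : ‖u (k + T) - u l‖ ≤ ∑ j ∈ Finset.range T, ‖u (k + j + 1) - u (k + j)‖ := by
    rw [← dist_eq_norm, dist_comm]
    refine (dist_le_Ico_sum_dist u hlT).trans ?_
    refine (Finset.sum_le_sum_of_subset_of_nonneg (Finset.Ico_subset_Ico_left hkl)
      fun _ _ _ => dist_nonneg).trans (le_of_eq ?_)
    rw [Finset.sum_Ico_eq_sum_range, Nat.add_sub_cancel_left]
    exact Finset.sum_congr rfl fun j _ => by rw [dist_comm, dist_eq_norm]
  calc ‖u (k + T) - u l‖ ^ 2 ≤ (∑ j ∈ Finset.range T, ‖u (k + j + 1) - u (k + j)‖) ^ 2 :=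
        pow_le_pow_left₀ (norm_nonneg _) h1 2
    _ ≤ _ := by
        simpa using sq_sum_le_card_mul_sum_sq (s := Finset.range T)
          (f := fun j => ‖u (k + j + 1) - u (k + j)‖)

/-- Square summability of the increments of `u` carries over to the distances between `u` and a
copy of `u` with delays at most `T`. -/
theorem summable_sq_norm_sub_of_delay {E : Type*} [NormedAddCommGroup E] {u p : ℕ → E} {T : ℕ}
    (hu : Summable fun k => ‖u (k + 1) - u k‖ ^ 2)
    (hp : ∀ k, ∃ l, k ≤ l ∧ l < k + T ∧ p (k + T) = u l) :
    Summable fun k => ‖u k - p k‖ ^ 2 := by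
  rw [← summable_nat_add_iff T]
  refine Summable.of_nonneg_of_le (fun _ => by positivity) (fun k => ?_)
    ((summable_sum (s := Finset.range T) fun j _ => (summable_nat_add_iff j).2 hu).mul_left (T : ℝ))
  obtain ⟨l, hkl, hlT, hpl⟩ := hp k
  rw [hpl]
  exact sq_norm_sub_le_of_window u hkl hlT.le

end Sequences

/-! ### The algorithm as exact minimization of a majorant -/

section Algorithm

variable {E : Type*} {N : ℕ}

open Classical in
/-- The point at which the `i`-th table entry was last refreshed before iteration `k`
(the initial point, if it has not been refreshed yet). -/
noncomputable def refreshPoint (I : ℕ → Finset (Fin N)) (xinit : E) (z : ℕ → E) :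
    ℕ → Fin N → E
  | 0, _ => xinit
  | k + 1, i => if i ∈ I (k + 1) then z k else refreshPoint I xinit z k i

theorem refreshPoint_succ_of_mem {I : ℕ → Finset (Fin N)} (xinit : E) (z : ℕ → E) {k : ℕ}
    {i : Fin N} (hi : i ∈ I (k + 1)) : refreshPoint I xinit z (k + 1) i = z k := by
  rw [refreshPoint, if_pos hi]

theorem refreshPoint_succ_of_notMem {I : ℕ → Finset (Fin N)} (xinit : E) (z : ℕ → E) {k : ℕ}
    {i : Fin N} (hi : i ∉ I (k + 1)) :
    refreshPoint I xinit z (k + 1) i = refreshPoint I xinit z k i := by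
  rw [refreshPoint, if_neg hi]

theorem exists_refreshPoint_eq {I : ℕ → Finset (Fin N)} (xinit : E) (z : ℕ → E) {j : ℕ}
    {i : Fin N} (hi : i ∈ I (j + 1)) {m : ℕ} (hm : j + 1 ≤ m) :
    ∃ l, j ≤ l ∧ l < m ∧ refreshPoint I xinit z m i = z l := by
  induction m, hm using Nat.le_induction with
  | base => exact ⟨j, le_rfl, j.lt_succ_self, refreshPoint_succ_of_mem xinit z hi⟩
  | succ m hm ih =>
    by_cases him : i ∈ I (m + 1)
    · exact ⟨m, by omega, m.lt_succ_self, refreshPoint_succ_of_mem xinit z him⟩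
    · obtain ⟨l, hjl, hlm, hl⟩ := ih
      exact ⟨l, hjl, hlm.trans m.lt_succ_self, by
        rw [refreshPoint_succ_of_notMem xinit z him, hl]⟩

/-- Under the essentially cyclic rule the refresh points are iterates with bounded delay. -/
theorem EssentiallyCyclic.exists_delay {I : ℕ → Finset (Fin N)} (hI : EssentiallyCyclic I)
    (xinit : E) (z : ℕ → E) : ∃ T : ℕ, ∀ i k, ∃ l, k ≤ l ∧ l < k + T ∧
      refreshPoint I xinit z (k + T) i = z l := by
  obtain ⟨T, hT, hcov⟩ := hI
  refine ⟨T, fun i k => ?_⟩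
  have hi : i ∈ (Finset.Icc 1 T).biUnion (fun t => I (k + t)) := by
    rw [hcov k]
    exact Finset.mem_univ i
  obtain ⟨t, ht, hit⟩ := Finset.mem_biUnion.1 hi
  rw [Finset.mem_Icc] at ht
  obtain ⟨j, rfl⟩ : ∃ j, t = j + 1 := ⟨t - 1, by omega⟩
  obtain ⟨l, hl1, hl2, hl⟩ := exists_refreshPoint_eq xinit z (j := k + j) hit (m := k + T)
    (by omega)
  exact ⟨l, by omega, hl2, hl⟩

variable [NormedAddCommGroup E] [InnerProductSpace ℝ E] [CompleteSpace E]
variable {h f : Fin N → E → EReal} {g : E → EReal} {L γ : Fin N → ℝ}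
variable {xinit : E} {I : ℕ → Finset (Fin N)} {z : ℕ → E} {s : ℕ → Fin N → E} {st : ℕ → E}

namespace IsBFinito

theorem table_eq (halg : IsBFinito h f g γ xinit I z s st) (k : ℕ) (i : Fin N) :
    s k i = tableEntry h f γ i (refreshPoint I xinit z k i) := by
  induction k with
  | zero => exact halg.s_zero i
  | succ k ih =>
    by_cases hi : i ∈ I (k + 1)
    · rw [halg.s_succ_mem k i hi, refreshPoint_succ_of_mem xinit z hi]
    · rw [halg.s_succ_not_mem k i hi, refreshPoint_succ_of_notMem xinit z hi, ih]

theorem tableSum_eq (halg : IsBFinito h f g γ xinit I z s st) (k : ℕ) :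
    st k = ∑ i, s k i := by
  induction k with
  | zero => exact halg.st_zero
  | succ k ih =>
    rw [halg.st_succ, ih, Finset.sum_subset (Finset.subset_univ (I (k + 1))) (fun i _ hi => by
      rw [halg.s_succ_not_mem k i hi, sub_self]), Finset.sum_sub_distrib, add_sub_cancel]

theorem mem_innerProx (halg : IsBFinito h f g γ xinit I z s st) (k : ℕ) :
    z k ∈ innerProx h g γ (∑ i, tableEntry h f γ i (refreshPoint I xinit z k i)) := by
  have := halg.z_mem k
  rw [halg.tableSum_eq] at this
  simpa only [halg.table_eq] using this

theorem g_lt_top (halg : IsBFinito h f g γ xinit I z s st) (hb : BasicAssumption h f g L γ)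
    (hC : domC h = Set.univ) (k : ℕ) : g (z k) < ⊤ :=
  hb.lt_top_of_mem_innerProx hC (halg.z_mem k)

end IsBFinito

/-- The cost as a real number, meaningful on the domain of `g`. -/
noncomputable def costReal (f : Fin N → E → EReal) (g : E → EReal) (w : E) : ℝ :=
  (N : ℝ)⁻¹ * ∑ i, realVal (f i) w + realVal g w

/-- The majorant `w ↦ φ(w) + ∑ D_{ĥ_i}(w, y_i)` of the cost. -/
noncomputable def majorant (h f : Fin N → E → EReal) (g : E → EReal) (γ : Fin N → ℝ)
    (y : Fin N → E) (w : E) : ℝ :=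
  costReal f g w + ∑ i, bregReal (hatReal h f γ i) w (y i)

theorem BasicAssumption.cost_eq_costReal (hb : BasicAssumption h f g L γ)
    (hC : domC h = Set.univ) {w : E} (hw : g w < ⊤) : cost f g w = (costReal f g w : EReal) := by
  rw [hb.cost_eq hC, coe_realVal hb.g_proper hw, ← EReal.coe_add]
  rfl

theorem BasicAssumption.exists_costReal_lower_bound (hb : BasicAssumption h f g L γ)
    (hC : domC h = Set.univ) : ∃ m : ℝ, ∀ w, g w < ⊤ → m ≤ costReal f g w := by
  obtain ⟨x, _, hx, hmin⟩ := hb.argmin_nonempty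
  have hgx : g x < ⊤ := by
    rw [hb.cost_eq hC] at hx
    refine lt_top_iff_ne_top.2 fun htop => ?_
    rw [htop, EReal.coe_add_top] at hx
    exact hx.false
  refine ⟨costReal f g x, fun w hw => ?_⟩
  have := hmin w (by rw [hC, closure_univ]; trivial)
  rwa [hb.cost_eq_costReal hC hgx, hb.cost_eq_costReal hC hw, EReal.coe_le_coe_iff] at this

variable [FiniteDimensional ℝ E]

/-- Up to a constant, the majorant is the objective of the inner problem at `∑ ∇ĥ_i(y_i)`. -/
theorem BasicAssumption.majorant_eq (hb : BasicAssumption h f g L γ) (hC : domC h = Set.univ)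
    (y : Fin N → E) (w : E) :
    majorant h f g γ y w =
      realVal g w + (∑ i, (γ i)⁻¹ * realVal (h i) w -
        inner ℝ (∑ i, tableEntry h f γ i (y i)) w) +
      ∑ i, (inner ℝ (tableEntry h f γ i (y i)) (y i) - hatReal h f γ i (y i)) := by
  have hsum : ∑ i, bregReal (hatReal h f γ i) w (y i) =
      ∑ i, (γ i)⁻¹ * realVal (h i) w - (N : ℝ)⁻¹ * ∑ i, realVal (f i) w -
        ∑ i, inner ℝ (tableEntry h f γ i (y i)) w +
        ∑ i, (inner ℝ (tableEntry h f γ i (y i)) (y i) - hatReal h f γ i (y i)) := by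
    rw [Finset.mul_sum, ← Finset.sum_sub_distrib, ← Finset.sum_sub_distrib,
      ← Finset.sum_add_distrib]
    refine Finset.sum_congr rfl fun i _ => ?_
    unfold bregReal
    rw [hb.gradient_hatReal hC, inner_sub_right]
    unfold hatReal
    ring
  unfold majorant costReal
  rw [hsum, sum_inner]
  ring

theorem majorant_le_of_mem_innerProx (hb : BasicAssumption h f g L γ) (hC : domC h = Set.univ)
    (hg : IsConvexFun g) {y : Fin N → E} {x : E}
    (hx : x ∈ innerProx h g γ (∑ i, tableEntry h f γ i (y i))) {w : E} (hw : g w < ⊤) :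
    majorant h f g γ y x + ∑ i, (γ i)⁻¹ * bregReal (realVal (h i)) w x ≤
      majorant h f g γ y w := by
  have := hb.innerProx_add_bregReal_le hC hg hx hw
  rw [hb.majorant_eq hC, hb.majorant_eq hC]
  linarith

namespace IsBFinito

theorem residual_eq (halg : IsBFinito h f g γ xinit I z s st) (hN : 0 < N)
    (hb : BasicAssumption h f g L γ) (hC : domC h = Set.univ)
    (hs : ∀ i, LocallyStronglyConvex (h i)) (k : ℕ) (i : Fin N) :
    residual h f γ i (s k i) (z k) =
      (bregReal (hatReal h f γ i) (z k) (refreshPoint I xinit z k i) : EReal) := by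
  rw [halg.table_eq, hb.residual_tableEntry hC hN (hs i)]

theorem lyapunov_eq (halg : IsBFinito h f g γ xinit I z s st) (hN : 0 < N)
    (hb : BasicAssumption h f g L γ) (hC : domC h = Set.univ)
    (hs : ∀ i, LocallyStronglyConvex (h i)) (k : ℕ) :
    lyapunov h f g γ (z k) (s k) =
      (majorant h f g γ (refreshPoint I xinit z k) (z k) : EReal) := by
  unfold lyapunov majorant
  simp_rw [fun i => halg.residual_eq hN hb hC hs k i]
  rw [hb.cost_eq_costReal hC (halg.g_lt_top hb hC k), EReal.coe_add]
  congr 1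
  exact (map_sum (⟨⟨Real.toEReal, rfl⟩, EReal.coe_add⟩ : ℝ →+ EReal) _ _).symm

/-- Sufficient decrease of the Lyapunov function. Refreshing a table entry at `z k` makes the
corresponding Bregman distance vanish, so the majorant does not increase at `z k`, and the
three-point inequality gives the rest. -/
theorem descent (halg : IsBFinito h f g γ xinit I z s st) (hN : 0 < N)
    (hb : BasicAssumption h f g L γ) (hC : domC h = Set.univ) (hg : IsConvexFun g) (k : ℕ) :
    majorant h f g γ (refreshPoint I xinit z (k + 1)) (z (k + 1)) +
        ∑ i, (γ i)⁻¹ * bregReal (realVal (h i)) (z k) (z (k + 1)) ≤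
      majorant h f g γ (refreshPoint I xinit z k) (z k) := by
  refine (majorant_le_of_mem_innerProx hb hC hg (halg.mem_innerProx (k + 1))
    (halg.g_lt_top hb hC k)).trans ?_
  unfold majorant
  gcongr with i
  by_cases hi : i ∈ I (k + 1)
  · rw [refreshPoint_succ_of_mem xinit z hi, bregReal_self]
    exact hb.bregReal_hatReal_nonneg hC hN i _ _
  · rw [refreshPoint_succ_of_notMem xinit z hi]

end IsBFinito

theorem costReal_le_majorant (hN : 0 < N) (hb : BasicAssumption h f g L γ)
    (hC : domC h = Set.univ) (y : Fin N → E) (w : E) :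
    costReal f g w ≤ majorant h f g γ y w :=
  le_add_of_nonneg_right (Finset.sum_nonneg fun i _ => hb.bregReal_hatReal_nonneg hC hN i _ _)

namespace IsBFinito

theorem antitone_majorant (halg : IsBFinito h f g γ xinit I z s st) (hN : 0 < N)
    (hb : BasicAssumption h f g L γ) (hC : domC h = Set.univ) (hg : IsConvexFun g) :
    Antitone fun k => majorant h f g γ (refreshPoint I xinit z k) (z k) :=
  antitone_nat_of_succ_le fun k => by
    have h1 := halg.descent hN hb hC hg k
    have h2 : 0 ≤ ∑ i, (γ i)⁻¹ * bregReal (realVal (h i)) (z k) (z (k + 1)) :=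
      Finset.sum_nonneg fun i _ => mul_nonneg (inv_nonneg.2 (hb.stepsize_pos i).le)
        (bregReal_nonneg (hb.convexOn_kernel hC i) (hb.differentiable_kernel hC i _) _)
    linarith

/-- The iterate `z k` minimizes the majorant built from the current table. -/
theorem majorant_le (halg : IsBFinito h f g γ xinit I z s st) (hb : BasicAssumption h f g L γ)
    (hC : domC h = Set.univ) (hg : IsConvexFun g) (k : ℕ) {w : E} (hw : g w < ⊤) :
    majorant h f g γ (refreshPoint I xinit z k) (z k) ≤
      majorant h f g γ (refreshPoint I xinit z k) w := by
  refine le_trans (le_add_of_nonneg_right (Finset.sum_nonneg fun i _ =>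
    mul_nonneg (inv_nonneg.2 (hb.stepsize_pos i).le) ?_))
    (majorant_le_of_mem_innerProx hb hC hg (halg.mem_innerProx k) hw)
  exact bregReal_nonneg (hb.convexOn_kernel hC i) (hb.differentiable_kernel hC i _) _

/-- If the kernels are uniformly strongly convex along the iterates, in the form of a quadratic
lower bound on their Bregman distances, then the increments of the iterates are square summable by
the descent inequality, and so are the distances to the refresh points. -/
theorem summable_sq_delay (halg : IsBFinito h f g γ xinit I z s st) (hN : 0 < N)
    (hb : BasicAssumption h f g L γ) (hC : domC h = Set.univ) (hg : IsConvexFun g)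
    (hI : EssentiallyCyclic I)
    (hlow : ∀ i, ∃ c > 0, ∀ k l, c * ‖z k - z l‖ ^ 2 ≤ bregReal (realVal (h i)) (z k) (z l))
    (i : Fin N) : Summable fun k => ‖z k - refreshPoint I xinit z k i‖ ^ 2 := by
  obtain ⟨T, hT⟩ := hI.exists_delay xinit z
  refine summable_sq_norm_sub_of_delay ?_ (hT i)
  obtain ⟨m, hm⟩ := hb.exists_costReal_lower_bound hC
  have hnn : ∀ k j, 0 ≤ (γ j)⁻¹ * bregReal (realVal (h j)) (z k) (z (k + 1)) := fun k j =>
    mul_nonneg (inv_nonneg.2 (hb.stepsize_pos j).le)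
      (bregReal_nonneg (hb.convexOn_kernel hC j) (hb.differentiable_kernel hC j _) _)
  have hsum : Summable fun k => ∑ j, (γ j)⁻¹ * bregReal (realVal (h j)) (z k) (z (k + 1)) :=
    summable_of_descent (fun k => Finset.sum_nonneg fun j _ => hnn k j)
      (halg.descent hN hb hC hg)
      (fun k => (hm _ (halg.g_lt_top hb hC k)).trans (costReal_le_majorant hN hb hC _ _))
  obtain ⟨c, hc, hcl⟩ := hlow i
  have hcγ : 0 < (γ i)⁻¹ * c := mul_pos (inv_pos.2 (hb.stepsize_pos i)) hc
  rw [← summable_mul_left_iff hcγ.ne']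
  refine Summable.of_nonneg_of_le (fun k => by positivity) (fun k => ?_) hsum
  refine le_trans ?_ (Finset.single_le_sum (fun j _ => hnn k j) (Finset.mem_univ i))
  rw [mul_assoc, norm_sub_rev]
  exact mul_le_mul_of_nonneg_left (hcl k (k + 1)) (inv_nonneg.2 (hb.stepsize_pos i).le)

theorem summable_residual (halg : IsBFinito h f g γ xinit I z s st) (hN : 0 < N)
    (hb : BasicAssumption h f g L γ) (hC : domC h = Set.univ) (hg : IsConvexFun g)
    (hI : EssentiallyCyclic I)
    (hlow : ∀ i, ∃ c > 0, ∀ k l, c * ‖z k - z l‖ ^ 2 ≤ bregReal (realVal (h i)) (z k) (z l))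
    (hup : ∀ i, ∃ K : ℝ, ∀ k l, bregReal (realVal (h i)) (z k) (z l) ≤ K * ‖z k - z l‖ ^ 2)
    (i : Fin N) :
    Summable fun k => bregReal (hatReal h f γ i) (z k) (refreshPoint I xinit z k i) := by
  obtain ⟨T, hT⟩ := hI.exists_delay xinit z
  obtain ⟨K, hK⟩ := hup i
  rw [← summable_nat_add_iff T]
  refine Summable.of_nonneg_of_le (fun k => hb.bregReal_hatReal_nonneg hC hN i _ _) (fun k => ?_)
    (((summable_nat_add_iff T).2 (halg.summable_sq_delay hN hb hC hg hI hlow i)).mul_left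
      (((γ i)⁻¹ + L i / N) * K))
  refine (hb.bregReal_hatReal_le hC i _ _).trans ?_
  rw [mul_assoc]
  refine mul_le_mul_of_nonneg_left ?_ (hb.upper_const_nonneg i)
  -- After the first `T` iterations the refresh point is an iterate, so the bound applies.
  obtain ⟨l, _, _, hl⟩ := hT i k
  rw [hl]
  exact hK (k + T) l

end IsBFinito

end Algorithm

/-! ### Limit points -/

section Limit

variable {E : Type*} [NormedAddCommGroup E] [InnerProductSpace ℝ E]

/-- A minorant of `φ` touching it at `x` up to `o(‖w - x‖)` makes `x` stationary. -/
theorem zero_mem_regSubdiff_of_isLittleO {φ : E → EReal} {x : E} {r : ℝ} (hx : φ x = (r : EReal))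
    {R : E → ℝ} (hR : R =o[𝓝 x] fun w => w - x) (hφ : ∀ w, ((r - R w : ℝ) : EReal) ≤ φ w) :
    (0 : E) ∈ regSubdiff φ x := by
  refine ⟨hx ▸ EReal.coe_lt_top r, ?_⟩
  refine EReal.ge_of_forall_gt_iff_ge.1 fun c hc => ?_
  rw [EReal.coe_neg'] at hc
  refine le_liminf_of_le (by isBoundedDefault) ?_
  have hev := (hR.def (neg_pos.2 hc)).filter_mono (nhdsWithin_le_nhds (s := {x}ᶜ))
  filter_upwards [hev, self_mem_nhdsWithin] with w hw hne
  have hpos : 0 < ‖w - x‖ := norm_pos_iff.2 (sub_ne_zero.2 hne)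
  rw [EReal.le_div_iff_mul_le (EReal.coe_pos.2 hpos) (EReal.coe_ne_top _), inner_zero_left,
    EReal.coe_zero, sub_zero, hx]
  refine le_trans ?_ (EReal.sub_le_sub (hφ w) le_rfl)
  rw [← EReal.coe_sub, ← EReal.coe_mul, EReal.coe_le_coe_iff]
  have := le_abs_self (R w)
  rw [Real.norm_eq_abs] at hw
  linarith

end Limit

section LimitPoint

variable {E : Type*} [NormedAddCommGroup E] [InnerProductSpace ℝ E] [FiniteDimensional ℝ E]
variable {N : ℕ} {h f : Fin N → E → EReal} {g : E → EReal} {L γ : Fin N → ℝ}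

/-- Lower semicontinuity of the cost along a sequence with convergent cost values. -/
theorem BasicAssumption.cost_le_of_tendsto [CompleteSpace E] (hb : BasicAssumption h f g L γ)
    (hC : domC h = Set.univ) {u : ℕ → E} {x : E} (hu : Tendsto u atTop (𝓝 x))
    (hgu : ∀ k, g (u k) < ⊤) {r : ℝ}
    (hr : Tendsto (fun k => costReal f g (u k)) atTop (𝓝 r)) :
    g x < ⊤ ∧ costReal f g x ≤ r := by
  have hF : Continuous fun w => (N : ℝ)⁻¹ * ∑ i, realVal (f i) w :=
    continuous_const.mul (continuous_finsetSum _ fun i _ =>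
      (hb.differentiable_summand hC i).continuous)
  have hgr : Tendsto (fun k => realVal g (u k)) atTop
      (𝓝 (r - (N : ℝ)⁻¹ * ∑ i, realVal (f i) x)) := by
    refine (hr.sub ((hF.tendsto x).comp hu)).congr fun k => ?_
    simp [costReal]
  have hle : g x ≤ ((r - (N : ℝ)⁻¹ * ∑ i, realVal (f i) x : ℝ) : EReal) := by
    by_contra! hlt
    obtain ⟨b, hb1, hb2⟩ := EReal.exists_between_coe_real hlt
    have hev : ∀ᶠ k in atTop, b ≤ realVal g (u k) := by
      filter_upwards [hu.eventually (hb.g_lsc x b hb2)] with k hk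
      rw [coe_realVal hb.g_proper (hgu k)] at hk
      exact (EReal.coe_lt_coe_iff.1 hk).le
    exact (EReal.coe_lt_coe_iff.1 hb1).not_ge (ge_of_tendsto hgr hev)
  have hlt := hle.trans_lt (EReal.coe_lt_top _)
  refine ⟨hlt, ?_⟩
  rw [coe_realVal hb.g_proper hlt, EReal.coe_le_coe_iff] at hle
  unfold costReal
  linarith

/-- In the limit, minimality of the iterates for the majorants gives a global lower bound on the
cost in terms of the Bregman distances of the kernels to the limit point. -/
theorem BasicAssumption.le_of_tendsto_majorant [CompleteSpace E]
    (hb : BasicAssumption h f g L γ) (hC : domC h = Set.univ) {x w : E} {r : ℝ}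
    {Λ : ℕ → ℝ} {y : ℕ → Fin N → E} (hΛ : Tendsto Λ atTop (𝓝 r))
    (hy : ∀ i, Tendsto (fun k => y k i) atTop (𝓝 x))
    (hle : ∀ k, Λ k ≤ majorant h f g γ (y k) w) :
    r ≤ costReal f g w + ∑ i, ((γ i)⁻¹ + L i / N) * bregReal (realVal (h i)) w x := by
  have hlim : Tendsto (fun k => costReal f g w +
      ∑ i, ((γ i)⁻¹ + L i / N) * bregReal (realVal (h i)) w (y k i)) atTop
      (𝓝 (costReal f g w + ∑ i, ((γ i)⁻¹ + L i / N) * bregReal (realVal (h i)) w x)) :=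
    (tendsto_finsetSum _ fun i _ => (tendsto_bregReal (hb.differentiable_kernel hC i).continuous
      (hb.continuous_gradient_kernel hC i) (hy i) w).const_mul _).const_add _
  refine le_of_tendsto_of_tendsto' hΛ hlim fun k => (hle k).trans ?_
  unfold majorant
  gcongr with i
  exact hb.bregReal_hatReal_le hC i _ _

/-- If the points `u k` and the base points `y k i` of the majorants converge to `x`, while the costs
at `u k` and lower bounds `Λ k` of the majorants converge to the same value, then the cost attains
this value at `x` and `x` is stationary. -/
theorem BasicAssumption.cost_eq_and_stationary [CompleteSpace E]
    (hb : BasicAssumption h f g L γ) (hC : domC h = Set.univ) {u : ℕ → E} {x : E} {r : ℝ}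
    (hu : Tendsto u atTop (𝓝 x)) (hgu : ∀ k, g (u k) < ⊤)
    (hr : Tendsto (fun k => costReal f g (u k)) atTop (𝓝 r))
    {Λ : ℕ → ℝ} {y : ℕ → Fin N → E} (hΛ : Tendsto Λ atTop (𝓝 r))
    (hy : ∀ i, Tendsto (fun k => y k i) atTop (𝓝 x))
    (hle : ∀ w, g w < ⊤ → ∀ k, Λ k ≤ majorant h f g γ (y k) w) :
    cost f g x = (r : EReal) ∧ (0 : E) ∈ regSubdiff (cost f g) x := by
  obtain ⟨hgx, hcx⟩ := hb.cost_le_of_tendsto hC hu hgu hr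
  have hlower := fun w (hw : g w < ⊤) => hb.le_of_tendsto_majorant hC hΛ hy (hle w hw)
  have heq : costReal f g x = r := by
    refine le_antisymm hcx ?_
    simpa [bregReal_self] using hlower x hgx
  have hcost : cost f g x = (r : EReal) := by rw [hb.cost_eq_costReal hC hgx, heq]
  refine ⟨hcost, zero_mem_regSubdiff_of_isLittleO hcost
    (R := fun w => ∑ i, ((γ i)⁻¹ + L i / N) * bregReal (realVal (h i)) w x) ?_ fun w => ?_⟩
  · exact Asymptotics.IsLittleO.fun_sum fun i _ =>
      (bregReal_isLittleO (hb.differentiable_kernel hC i x)).const_mul_left _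
  · by_cases hw : g w < ⊤
    · rw [hb.cost_eq_costReal hC hw, EReal.coe_le_coe_iff]
      linarith [hlower w hw]
    · rw [hb.cost_eq hC, not_lt_top_iff.1 hw, EReal.coe_add_top]
      exact le_top

end LimitPoint

/-! ### Quadratic bounds on Bregman distances -/

section Bounds

variable {E : Type*} [NormedAddCommGroup E] [InnerProductSpace ℝ E]

theorem StronglyConvex.locallyStronglyConvex {h : E → EReal} (hs : StronglyConvex h) :
    LocallyStronglyConvex h := fun _ => by
  obtain ⟨μ, hμ, hsc⟩ := hs
  exact ⟨Set.univ, univ_mem, μ, hμ, hsc⟩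

variable [CompleteSpace E]

theorem StronglyConvex.exists_bregReal_ge {h : E → EReal} (hs : StronglyConvex h)
    (hd : Differentiable ℝ (realVal h)) :
    ∃ c > 0, ∀ x y : E, c * ‖x - y‖ ^ 2 ≤ bregReal (realVal h) x y := by
  obtain ⟨μ, hμ, hsc⟩ := hs
  exact ⟨μ / 2, half_pos hμ, fun x y =>
    bregReal_ge_of_strongConvexOn hsc (Set.mem_univ x) (Set.mem_univ y) (hd y)⟩

theorem LipschitzDifferentiable.exists_bregReal_le {h : E → EReal}
    (hs : LipschitzDifferentiable h) (hF : ConvexOn ℝ Set.univ (realVal h)) :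
    ∃ K : ℝ, ∀ x y : E, bregReal (realVal h) x y ≤ K * ‖x - y‖ ^ 2 := by
  obtain ⟨hd, K, hK⟩ := hs
  exact ⟨K, fun x y => bregReal_le_of_lipschitzOnWith hF hd (hK.lipschitzOnWith (s := Set.univ))
    (Set.mem_univ x) (Set.mem_univ y)⟩

theorem LocallyStronglyConvex.exists_bregReal_ge {h : E → EReal}
    (hs : LocallyStronglyConvex h) (hF : ConvexOn ℝ Set.univ (realVal h))
    (hd : Differentiable ℝ (realVal h)) {S : Set E} (hS : IsCompact S) :
    ∃ c > 0, ∀ x ∈ S, ∀ y ∈ S, c * ‖x - y‖ ^ 2 ≤ bregReal (realVal h) x y := by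
  obtain ⟨a, ha, δ, hδ, H⟩ := exists_bregReal_growth hF hd hs hS
  obtain ⟨R, hR, hRS⟩ : ∃ R > 0, ∀ x ∈ S, ∀ y ∈ S, ‖x - y‖ ≤ R := by
    obtain ⟨R, hR⟩ := Metric.isBounded_iff.1 hS.isBounded
    exact ⟨max R 1, lt_max_of_lt_right one_pos, fun x hx y hy =>
      (dist_eq_norm x y ▸ hR hx hy).trans (le_max_left _ _)⟩
  refine ⟨a * min 1 (δ / R), by positivity, fun x hx y hy => le_trans ?_ (H y hy x)⟩
  rw [mul_assoc]
  refine mul_le_mul_of_nonneg_left ?_ ha.le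
  rw [sq, mul_left_comm]
  refine mul_le_mul_of_nonneg_left (le_min ?_ ?_) (norm_nonneg _)
  · exact mul_le_of_le_one_left (norm_nonneg _) (min_le_left _ _)
  · calc min 1 (δ / R) * ‖x - y‖ ≤ δ / R * R := by
          gcongr
          · exact min_le_right _ _
          · exact hRS x hx y hy
      _ = δ := div_mul_cancel₀ _ hR.ne'

theorem LocallyLipschitzDifferentiable.exists_bregReal_le {h : E → EReal}
    (hs : LocallyLipschitzDifferentiable h) (hF : ConvexOn ℝ Set.univ (realVal h))
    {S : Set E} (hS : IsCompact S) :
    ∃ K : ℝ, ∀ x ∈ S, ∀ y ∈ S, bregReal (realVal h) x y ≤ K * ‖x - y‖ ^ 2 := by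
  obtain ⟨K, hK⟩ :=
    LocallyLipschitzOn.exists_lipschitzOnWith_of_compact hS (hs.2.locallyLipschitzOn (s := S))
  exact ⟨K, fun x hx y hy => bregReal_le_of_lipschitzOnWith hF hs.1 hK hx hy⟩

end Bounds

/-! ### Bounds along the iterates -/

section Iterates

variable {E : Type*} [NormedAddCommGroup E] [InnerProductSpace ℝ E] [CompleteSpace E]
  [FiniteDimensional ℝ E]
variable {N : ℕ} {h f : Fin N → E → EReal} {g : E → EReal} {L γ : Fin N → ℝ}
variable {xinit : E} {I : ℕ → Finset (Fin N)} {z : ℕ → E} {s : ℕ → Fin N → E} {st : ℕ → E}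

theorem IsBFinito.exists_compact (halg : IsBFinito h f g γ xinit I z s st) (hN : 0 < N)
    (hb : BasicAssumption h f g L γ) (hC : domC h = Set.univ) (hg : IsConvexFun g)
    (hlev : LevelBounded (cost f g)) : ∃ S : Set E, IsCompact S ∧ ∀ k, z k ∈ S := by
  refine ⟨_, (hlev (majorant h f g γ (refreshPoint I xinit z 0) (z 0))).isCompact_closure,
    fun k => subset_closure ?_⟩
  change cost f g (z k) ≤ _
  rw [hb.cost_eq_costReal hC (halg.g_lt_top hb hC k), EReal.coe_le_coe_iff]
  exact (costReal_le_majorant hN hb hC _ _).trans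
    (halg.antitone_majorant hN hb hC hg (Nat.zero_le k))

/-- The initial cost bounds the Lyapunov function, as all Bregman distances in the first majorant
vanish at the initial point. -/
theorem IsBFinito.majorant_zero_le (halg : IsBFinito h f g γ xinit I z s st)
    (hb : BasicAssumption h f g L γ) (hC : domC h = Set.univ) (hg : IsConvexFun g) :
    (majorant h f g γ (refreshPoint I xinit z 0) (z 0) : EReal) ≤ cost f g xinit := by
  by_cases hx : g xinit < ⊤
  · rw [hb.cost_eq_costReal hC hx, EReal.coe_le_coe_iff]
    refine (halg.majorant_le hb hC hg 0 hx).trans (le_of_eq ?_)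
    simp [majorant, refreshPoint, bregReal_self]
  · rw [hb.cost_eq hC, not_lt_top_iff.1 hx, EReal.coe_add_top]
    exact le_top

end Iterates

end BFinito

open BFinito in
theorem mainTheorem4 {n N : ℕ} (hN : 0 < N)
    (h f : Fin N → EuclideanSpace ℝ (Fin n) → EReal)
    (g : EuclideanSpace ℝ (Fin n) → EReal)
    (L γ : Fin N → ℝ)
    (hbasic : BFinito.BasicAssumption h f g L γ)
    (hg : BFinito.IsConvexFun g)
    (hC : BFinito.domC h = Set.univ)
    (hreg :
      (∀ i, BFinito.StronglyConvex (h i) ∧ BFinito.LipschitzDifferentiable (h i)) ∨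
      (BFinito.LevelBounded (BFinito.cost f g) ∧
        ∀ i, BFinito.LocallyStronglyConvex (h i) ∧
          BFinito.LocallyLipschitzDifferentiable (h i)))
    (xinit : EuclideanSpace ℝ (Fin n))
    (I : ℕ → Finset (Fin N)) (hI : BFinito.EssentiallyCyclic I)
    (z : ℕ → EuclideanSpace ℝ (Fin n))
    (s : ℕ → Fin N → EuclideanSpace ℝ (Fin n))
    (st : ℕ → EuclideanSpace ℝ (Fin n))
    (halg : BFinito.IsBFinito h f g γ xinit I z s st) :
    -- the residuals are real numbers with finite sum, and in particular vanish
    (∀ i, ∃ r : ℕ → ℝ, (∀ k, BFinito.residual h f γ i (s k i) (z k) = (r k : EReal)) ∧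
      (∀ k, 0 ≤ r k) ∧ Summable r ∧ Tendsto r atTop (𝓝 0)) ∧
    -- `φs` is the finite limit of the nonincreasing Lyapunov sequence
    ∃ φs : ℝ,
      Antitone (fun k => BFinito.lyapunov h f g γ (z k) (s k)) ∧
      Tendsto (fun k => BFinito.lyapunov h f g γ (z k) (s k)) atTop (𝓝 (φs : EReal)) ∧
      (⨅ x, BFinito.cost f g x) ≤ (φs : EReal) ∧
      -- the cost along the iterates converges to `φs`
      Tendsto (fun k => BFinito.cost f g (z k)) atTop (𝓝 (φs : EReal)) ∧
      (φs : EReal) ≤ BFinito.cost f g xinit ∧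
      -- the cost is constant on the set of limit points
      (∀ zs, MapClusterPt zs atTop z → BFinito.cost f g zs = (φs : EReal)) ∧
      -- limit points are stationary
      (∀ zs, MapClusterPt zs atTop z → 0 ∈ BFinito.regSubdiff (BFinito.cost f g) zs) := by
  have hloc : ∀ i, LocallyStronglyConvex (h i) := fun i =>
    hreg.elim (fun H => (H i).1.locallyStronglyConvex) fun H => (H.2 i).1
  have hcvx := hbasic.convexOn_kernel hC
  have hdiff := hbasic.differentiable_kernel hC
  have hbounds : ∀ i,
      (∃ c > 0, ∀ k l, c * ‖z k - z l‖ ^ 2 ≤ bregReal (realVal (h i)) (z k) (z l)) ∧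
      ∃ K : ℝ, ∀ k l, bregReal (realVal (h i)) (z k) (z l) ≤ K * ‖z k - z l‖ ^ 2 := by
    intro i
    rcases hreg with H | ⟨hlev, H⟩
    · obtain ⟨c, hc, hlow⟩ := (H i).1.exists_bregReal_ge (hdiff i)
      obtain ⟨K, hup⟩ := (H i).2.exists_bregReal_le (hcvx i)
      exact ⟨⟨c, hc, fun k l => hlow _ _⟩, K, fun k l => hup _ _⟩
    · obtain ⟨S, hS, hzS⟩ := halg.exists_compact hN hbasic hC hg hlev
      obtain ⟨c, hc, hlow⟩ := (H i).1.exists_bregReal_ge (hcvx i) (hdiff i) hS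
      obtain ⟨K, hup⟩ := (H i).2.exists_bregReal_le (hcvx i) hS
      exact ⟨⟨c, hc, fun k l => hlow _ (hzS k) _ (hzS l)⟩, K,
        fun k l => hup _ (hzS k) _ (hzS l)⟩
  have hlow := fun i => (hbounds i).1
  have hsummable :=
    halg.summable_residual hN hbasic hC hg hI hlow fun i => (hbounds i).2
  refine ⟨fun i => ⟨_, fun k => halg.residual_eq hN hbasic hC hloc k i, fun k =>
    hbasic.bregReal_hatReal_nonneg hC hN i _ _, hsummable i, (hsummable i).tendsto_atTop_zero⟩, ?_⟩
  set Λ : ℕ → ℝ := fun k => majorant h f g γ (refreshPoint I xinit z k) (z k) with hΛdef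
  have hanti : Antitone Λ := halg.antitone_majorant hN hbasic hC hg
  have hgz := halg.g_lt_top hbasic hC
  obtain ⟨m, hm⟩ := hbasic.exists_costReal_lower_bound hC
  have hcostle : ∀ k, costReal f g (z k) ≤ Λ k := fun k => costReal_le_majorant hN hbasic hC _ _
  obtain ⟨φs, hΛ⟩ : ∃ r, Tendsto Λ atTop (𝓝 r) := by
    refine ⟨_, tendsto_atTop_ciInf hanti ⟨m, ?_⟩⟩
    rintro _ ⟨k, rfl⟩
    exact (hm _ (hgz k)).trans (hcostle k)
  have hcost : Tendsto (fun k => costReal f g (z k)) atTop (𝓝 φs) := by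
    have hres := tendsto_finsetSum Finset.univ fun i _ => (hsummable i).tendsto_atTop_zero
    have := hΛ.sub hres
    rw [Finset.sum_const_zero, sub_zero] at this
    refine this.congr fun k => ?_
    simp [hΛdef, majorant]
  have hlyap : (fun k => lyapunov h f g γ (z k) (s k)) = fun k => (Λ k : EReal) :=
    funext (halg.lyapunov_eq hN hbasic hC hloc)
  have hcostE : (fun k => cost f g (z k)) = fun k => (costReal f g (z k) : EReal) :=
    funext fun k => hbasic.cost_eq_costReal hC (hgz k)
  have hcostE' : Tendsto (fun k => cost f g (z k)) atTop (𝓝 (φs : EReal)) := by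
    rw [hcostE]
    exact EReal.tendsto_coe.2 hcost
  have hlimit : ∀ zs, MapClusterPt zs atTop z →
      cost f g zs = (φs : EReal) ∧ 0 ∈ regSubdiff (cost f g) zs := by
    intro zs hzs
    obtain ⟨ψ, hψ, hzψ⟩ := hzs.tendsto_subseq
    refine hbasic.cost_eq_and_stationary hC hzψ (fun k => hgz (ψ k))
      (hcost.comp hψ.tendsto_atTop) (hΛ.comp hψ.tendsto_atTop)
      (y := fun k => refreshPoint I xinit z (ψ k)) (fun i => ?_)
      fun w hw k => halg.majorant_le hbasic hC hg (ψ k) hw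
    have hsq := (halg.summable_sq_delay hN hbasic hC hg hI hlow i).tendsto_atTop_zero
    have hdelay : Tendsto (fun k => z k - refreshPoint I xinit z k i) atTop (𝓝 0) := by
      rw [tendsto_zero_iff_norm_tendsto_zero]
      simpa using hsq.sqrt
    have := hzψ.sub (hdelay.comp hψ.tendsto_atTop)
    rw [sub_zero] at this
    refine this.congr fun k => ?_
    simp
  refine ⟨φs, ?_, ?_, ?_, hcostE', ?_, fun zs hzs => (hlimit zs hzs).1,
    fun zs hzs => (hlimit zs hzs).2⟩
  · rw [hlyap]
    exact fun k l hkl => EReal.coe_le_coe_iff.2 (hanti hkl)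
  · rw [hlyap]
    exact EReal.tendsto_coe.2 hΛ
  · exact ge_of_tendsto' hcostE' fun k => iInf_le _ _
  · exact (EReal.coe_le_coe_iff.2 (hanti.le_of_tendsto hΛ 0)).trans
      (halg.majorant_zero_le hbasic hC hg)
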